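/- For $0<W<\tfrac12$ and an integer $N\ge 1$, let $\widetilde Q_{W,N}$ be the finite-rank integral operator on $L^2(-\tfrac12,\tfrac12)$ given by $$\widetilde Q_{W,N}f(x)=\int_{-W}^{W}\frac{\sin(N\pi(x-y))}{\sin(\pi(x-y))}\,f(y)\,dy ,\qquad x\in(-\tfrac12,\tfrac12),$$ and let $\widetilde\lambda_{0,N}(W)\ge\widetilde\lambda_{1,N}(W)\ge\cdots\ge\widetilde\lambda_{N-1,N}(W)>0$ be its positive eigenvalues in decreasing order, counted with multiplicity. Then for every real number $W$ with $0<W<\frac{2}{e\pi}$, every integer $N\ge 2$ and every integer $n$ with $\frac{e\pi W(N-1)}{2}<n\le N-1$, $$\widetilde\lambda_{n,N}(W)\le \frac{C_W}{\sqrt{N-1}\,\log\!\left(\frac{2n}{e\pi W(N-1)}\right)}\left(\frac{e\pi W(N-1)}{2n}\right)^{n-\frac12},\qquad C_W=\sqrt{2W}\left(2+\frac{2}{e\pi W}\right).$$ -/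

import Mathlib

open MeasureTheory

noncomputable section

/-- Lebesgue measure on the interval `(-1/2, 1/2)`. -/
def unitMeasure : Measure ℝ := volume.restrict (Set.Ioo (-1 / 2 : ℝ) (1 / 2))

instance : IsFiniteMeasure unitMeasure := by
  unfold unitMeasure
  infer_instance

/-- The complex Hilbert space `L²(-1/2, 1/2)`. -/
abbrev L2Unit : Type := Lp ℂ 2 unitMeasure

/-- The kernel `sin(Nπ(x-y)) / sin(π(x-y)) · 1_{[-W,W]}(y)`. On the diagonal `x = y`, a null set
of the integration variable, the quotient `0 / 0` takes the value `0`, which no integral sees. -/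
def dpswfKernel (N : ℕ) (W x y : ℝ) : ℝ :=
  Real.sin (N * Real.pi * (x - y)) / Real.sin (Real.pi * (x - y)) *
    Set.indicator (Set.Icc (-W) W) (fun _ => (1 : ℝ)) y

theorem abs_sin_nat_mul_le (N : ℕ) (t : ℝ) : |Real.sin (N * t)| ≤ N * |Real.sin t| := by
  induction N with
  | zero => simp
  | succ k ih =>
    have h : ((k + 1 : ℕ) : ℝ) * t = k * t + t := by push_cast; ring
    rw [h, Real.sin_add]
    have h1 : |Real.sin (k * t) * Real.cos t| ≤ |Real.sin (k * t)| := by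
      rw [abs_mul]
      exact mul_le_of_le_one_right (abs_nonneg _) (Real.abs_cos_le_one _)
    have h2 : |Real.cos (k * t) * Real.sin t| ≤ |Real.sin t| := by
      rw [abs_mul]
      exact mul_le_of_le_one_left (abs_nonneg _) (Real.abs_cos_le_one _)
    have h3 := abs_add_le (Real.sin (k * t) * Real.cos t) (Real.cos (k * t) * Real.sin t)
    push_cast
    linarith

theorem abs_dpswfKernel_le (N : ℕ) (W x y : ℝ) : |dpswfKernel N W x y| ≤ N := by
  unfold dpswfKernel
  have h0 := abs_sin_nat_mul_le N (Real.pi * (x - y))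
  rw [← mul_assoc] at h0
  have h1 : |Real.sin (N * Real.pi * (x - y)) / Real.sin (Real.pi * (x - y))| ≤ N := by
    rw [abs_div]
    exact div_le_of_le_mul₀ (abs_nonneg _) (Nat.cast_nonneg N) h0
  have h2 : |Set.indicator (Set.Icc (-W) W) (fun _ => (1 : ℝ)) y| ≤ 1 := by
    by_cases hy : y ∈ Set.Icc (-W) W <;> simp [hy]
  rw [abs_mul]
  exact le_trans (mul_le_of_le_one_right (abs_nonneg _) h2) h1

theorem measurable_dpswfKernel (N : ℕ) (W : ℝ) :
    Measurable (fun p : ℝ × ℝ => dpswfKernel N W p.1 p.2) := by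
  unfold dpswfKernel
  have h : Measurable (fun y : ℝ => Set.indicator (Set.Icc (-W) W) (fun _ => (1 : ℝ)) y) :=
    measurable_const.indicator measurableSet_Icc
  have h' : Measurable (fun p : ℝ × ℝ =>
      Set.indicator (Set.Icc (-W) W) (fun _ => (1 : ℝ)) p.2) := h.comp measurable_snd
  refine Measurable.mul ?_ h'
  fun_prop

theorem integrable_dpswfKernel_mul (N : ℕ) (W x : ℝ) (f : L2Unit) :
    Integrable (fun y => (dpswfKernel N W x y : ℂ) * f y) unitMeasure := by
  have hf : Integrable f unitMeasure := (Lp.memLp f).integrable (by norm_num)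
  have hk : Measurable (dpswfKernel N W x) :=
    Measurable.of_uncurry_left (f := dpswfKernel N W) (measurable_dpswfKernel N W)
  have h : Measurable (fun y : ℝ => (dpswfKernel N W x y : ℂ)) := by fun_prop
  have hm : AEStronglyMeasurable (fun y : ℝ => (dpswfKernel N W x y : ℂ) * f y) unitMeasure :=
    h.aestronglyMeasurable.mul hf.aestronglyMeasurable
  have hg : Integrable (fun y : ℝ => (N : ℝ) * ‖f y‖) unitMeasure := hf.norm.const_mul (N : ℝ)
  have hb : ∀ y : ℝ, ‖(dpswfKernel N W x y : ℂ) * f y‖ ≤ (N : ℝ) * ‖f y‖ := by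
    intro y
    rw [norm_mul, Complex.norm_real, Real.norm_eq_abs]
    exact mul_le_mul_of_nonneg_right (abs_dpswfKernel_le N W x y) (norm_nonneg _)
  exact hg.mono' hm (Filter.Eventually.of_forall hb)

theorem memLp_dpswfKernel_integral (N : ℕ) (W : ℝ) (f : L2Unit) :
    MemLp (fun x => ∫ y, (dpswfKernel N W x y : ℂ) * f y ∂unitMeasure) 2 unitMeasure := by
  have hf : Integrable f unitMeasure := (Lp.memLp f).integrable (by norm_num)
  refine MemLp.of_bound ?_ (∫ y, N * ‖f y‖ ∂unitMeasure) ?_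
  · have h : AEStronglyMeasurable
        (fun p : ℝ × ℝ => (dpswfKernel N W p.1 p.2 : ℂ) * f p.2)
        (unitMeasure.prod unitMeasure) :=
      (Complex.measurable_ofReal.comp (measurable_dpswfKernel N W)).aestronglyMeasurable.mul
        hf.aestronglyMeasurable.comp_snd
    exact h.integral_prod_right'
  · refine Filter.Eventually.of_forall fun x => ?_
    refine norm_integral_le_of_norm_le (hf.norm.const_mul _) ?_
    refine Filter.Eventually.of_forall fun y => ?_
    rw [norm_mul, Complex.norm_real, Real.norm_eq_abs]
    exact mul_le_mul_of_nonneg_right (abs_dpswfKernel_le N W x y) (norm_nonneg _)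

/-- The integral operator `f ↦ ∫_{-W}^{W} sin(Nπ(x-y)) / sin(π(x-y)) f(y) dy`
on `L²(-1/2, 1/2)`. -/
def dpswfOperator (N : ℕ) (W : ℝ) : L2Unit →ₗ[ℂ] L2Unit where
  toFun f := (memLp_dpswfKernel_integral N W f).toLp
    (fun x => ∫ y, (dpswfKernel N W x y : ℂ) * f y ∂unitMeasure)
  map_add' f g := by
    rw [← MemLp.toLp_add]
    congr 1
    funext x
    rw [Pi.add_apply, ← integral_add (integrable_dpswfKernel_mul N W x f)
      (integrable_dpswfKernel_mul N W x g)]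
    refine integral_congr_ae ?_
    filter_upwards [Lp.coeFn_add f g] with y hy
    rw [hy, Pi.add_apply, mul_add]
  map_smul' c f := by
    rw [RingHom.id_apply, ← MemLp.toLp_const_smul]
    congr 1
    funext x
    rw [Pi.smul_apply, ← integral_smul]
    refine integral_congr_ae ?_
    filter_upwards [Lp.coeFn_smul c f] with y hy
    rw [hy, Pi.smul_apply, smul_eq_mul, smul_eq_mul]
    ring

/-- The `n`-th (`n = 0, 1, 2, …`) positive eigenvalue of the operator in decreasing order, counted
with multiplicity: the largest `μ > 0` such that the eigenspaces of the eigenvalues `≥ μ` together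
span a space of dimension at least `n + 1`. -/
def dpswfEigenvalue (N : ℕ) (W : ℝ) (n : ℕ) : ℝ :=
  sSup {μ : ℝ | 0 < μ ∧ ((n + 1 : ℕ) : Cardinal) ≤
    Module.rank ℂ
      (⨆ ν ∈ Set.Ici μ, Module.End.eigenspace (dpswfOperator N W) (ν : ℂ) : Submodule ℂ L2Unit)}

end

/-!
The Dirichlet kernel is `∑ₖ eₖ(x) conj (eₖ(y))` with the exponentials
`eₖ(x) = exp (iπ(2k - (N - 1))x)`, `k < N`, which are orthonormal in `L²(-1/2, 1/2)`. Hence the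
operator maps into their span, is symmetric there, and its quadratic form at `f = ∑ bₖ eₖ` is the
energy `∫_{-W}^{W} |f|²` (`inner_dpswfOperator`).

If the eigenspaces for eigenvalues `≥ μ` together have dimension at least `n + 1`, their sum
contains some `f ≠ 0` that vanishes at the `n` Chebyshev nodes of `[-W, W]`. On one hand
`μ ‖f‖² ≤ ∫_{-W}^{W} |f|²` (`mul_norm_sq_le_re_inner_of_mem_iSup_eigenspace`). On the other hand,
as the frequencies of `f` are at most `π(N - 1)`, the error bound of Chebyshev interpolation gives
`|f| ≤ 2 (π(N - 1)W / 2)ⁿ / n! · √N ‖f‖` on `[-W, W]`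
(`norm_sum_cexp_le_of_eq_zero_chebyshev_nodes`, `re_inner_dpswfOperator_le`).

With `x = eπW(N - 1) / (2n) < 1`, Stirling's formula bounds the resulting estimate of `μ` by
`16 x^(2n+1) / (eπ²)`. The target is at least `2 xⁿ / (√(eπ) √n x log(1/x))`, and the comparison of
the two comes down to `(n + 2) log(1/x) x^(n+2) ≤ 1` (`energy_bound_le`).
-/

/-! ### Chebyshev interpolation -/

/-- Generalized Rolle theorem: a function with `n + 1` zeros has a zero of its `n`-th derivative. -/
theorem exists_iteratedDeriv_eq_zero {n : ℕ} {f : ℝ → ℝ} (hf : ContDiff ℝ n f)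
    {z : Fin (n + 1) → ℝ} (hz : StrictMono z) (h0 : ∀ i, f (z i) = 0) :
    ∃ ξ, iteratedDeriv n f ξ = 0 := by
  induction n generalizing f with
  | zero => exact ⟨z 0, by simpa using h0 0⟩
  | succ n ih =>
    have hcont : Continuous f := hf.continuous
    have rolle : ∀ i : Fin (n + 1), ∃ c ∈ Set.Ioo (z i.castSucc) (z i.succ), deriv f c = 0 :=
      fun i => exists_deriv_eq_zero (hz i.castSucc_lt_succ) hcont.continuousOn
        ((h0 _).trans (h0 _).symm)
    choose w hw hw0 using rolle
    have hwm : StrictMono w := by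
      rw [Fin.strictMono_iff_lt_succ]
      intro i
      have h1 := (hw i.castSucc).2
      have h2 := (hw i.succ).1
      rw [Fin.succ_castSucc] at h1
      exact h1.trans h2
    have hd : ContDiff ℝ n (deriv f) := by
      have := (contDiff_succ_iff_deriv (n := (n : WithTop ℕ∞))).1 (by exact_mod_cast hf)
      exact this.2.2
    obtain ⟨ξ, hξ⟩ := ih hd hwm hw0
    exact ⟨ξ, by rwa [iteratedDeriv_succ']⟩

theorem iteratedDeriv_polynomial_eval (n : ℕ) (p : Polynomial ℝ) :
    iteratedDeriv n (fun x => p.eval x) = fun x => (Polynomial.derivative^[n] p).eval x := by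
  induction n generalizing p with
  | zero => simp
  | succ n ih =>
    rw [iteratedDeriv_succ', Function.iterate_succ_apply, ← ih]
    congr 1
    funext x
    exact p.deriv

/-- The `n`-th derivative of `T_n` is constant, and `T_n` has leading coefficient `2 ^ (n - 1)`
(also for `n = 0`, by truncated subtraction). -/
theorem iteratedDeriv_chebyshev {n : ℕ} (x : ℝ) :
    iteratedDeriv n (fun x => (Polynomial.Chebyshev.T ℝ n).eval x) x = n.factorial * 2 ^ (n - 1) := by
  rw [iteratedDeriv_polynomial_eval]
  have hdeg : (Polynomial.Chebyshev.T ℝ n).natDegree = n := by simp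
  have h := Polynomial.natDegree_iterate_derivative (Polynomial.Chebyshev.T ℝ n) n
  rw [hdeg, Nat.sub_self, Nat.le_zero] at h
  beta_reduce
  rw [Polynomial.eq_C_of_natDegree_eq_zero h, Polynomial.eval_C, Polynomial.coeff_iterate_derivative,
    zero_add, Nat.descFactorial_self, nsmul_eq_mul]
  have : (Polynomial.Chebyshev.T ℝ n).coeff n = 2 ^ (n - 1) := by
    have := Polynomial.Chebyshev.leadingCoeff_T ℝ n
    rw [Polynomial.leadingCoeff, hdeg] at this
    simpa using this
  rw [this]

/-- The error bound of interpolation at the Chebyshev nodes, for the interpolating polynomial `0`.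
At a point `x` that is not a node, `h - l • T_n` with `l = h x / T_n x` has `n + 1` zeros, so
Rolle's theorem gives `h⁽ⁿ⁾ ξ = l * n! * 2 ^ (n - 1)` for some `ξ`, which bounds `l`. -/
theorem abs_le_of_eq_zero_chebyshev_nodes {n : ℕ} (hn : n ≠ 0) {h : ℝ → ℝ} (hh : ContDiff ℝ n h)
    {M : ℝ} (hM : ∀ t, |iteratedDeriv n h t| ≤ M)
    (h0 : ∀ k : Fin n, h (Real.cos ((2 * (k : ℕ) + 1) * Real.pi / (2 * n))) = 0)
    {x : ℝ} (hx : |x| ≤ 1) : |h x| ≤ 2 * M / (2 ^ n * n.factorial) := by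
  have hM0 : 0 ≤ M := (abs_nonneg _).trans (hM 0)
  set T : ℝ → ℝ := fun x => (Polynomial.Chebyshev.T ℝ n).eval x with hT
  have hTc : ContDiff ℝ n T := by
    have := (Polynomial.Chebyshev.T ℝ n).contDiff_aeval (R := ℝ) (𝕜 := ℝ) n
    simpa [hT, Polynomial.aeval_def] using this
  have hroots : (Polynomial.Chebyshev.T ℝ n).roots =
      ((Finset.range n).image fun k : ℕ =>
        Real.cos ((2 * k + 1) * Real.pi / (2 * n))).val :=
    Polynomial.Chebyshev.roots_T_real n
  set R : Finset ℝ := (Finset.range n).image fun k : ℕ =>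
    Real.cos ((2 * k + 1) * Real.pi / (2 * n)) with hR
  have hT0 : (Polynomial.Chebyshev.T ℝ n) ≠ 0 := by
    intro h
    have := Polynomial.Chebyshev.natDegree_T ℝ n
    rw [h] at this
    simp at this
    exact hn this.symm
  have hmem : ∀ y, y ∈ R ↔ T y = 0 := by
    intro y
    rw [← Finset.mem_val, ← hroots, Polynomial.mem_roots hT0]
    rfl
  have hRcard : R.card = n := by
    rw [hR, Finset.card_image_of_injOn, Finset.card_range]
    exact (Finset.range n).nodup_map_iff_injOn.mp (Polynomial.Chebyshev.roots_T_real_nodup n)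
  have hhR : ∀ y ∈ R, h y = 0 := by
    intro y hy
    obtain ⟨k, hk, rfl⟩ := Finset.mem_image.1 hy
    exact h0 ⟨k, Finset.mem_range.1 hk⟩
  by_cases hTx : T x = 0
  · rw [hhR x ((hmem x).2 hTx), abs_zero]
    positivity
  set l : ℝ := h x / T x with hl
  have hxl : h x = l * T x := by rw [hl, div_mul_cancel₀ _ hTx]
  have hxR : x ∉ R := fun hx' => hTx ((hmem x).1 hx')
  have hcard : (insert x R).card = n + 1 := by rw [Finset.card_insert_of_notMem hxR, hRcard]
  obtain ⟨ξ, hξ⟩ := exists_iteratedDeriv_eq_zero (n := n) (f := h - fun y => l • T y)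
    (hh.sub (hTc.const_smul l)) ((insert x R).orderEmbOfFin hcard).strictMono (by
      intro i
      have hi := (insert x R).orderEmbOfFin_mem hcard i
      rcases Finset.mem_insert.1 hi with hi | hi
      · simp [hi, hxl]
      · simp [hhR _ hi, (hmem _).1 hi])
  rw [iteratedDeriv_sub hh.contDiffAt (hTc.const_smul l).contDiffAt,
    iteratedDeriv_fun_const_smul hTc.contDiffAt,
    iteratedDeriv_chebyshev, sub_eq_zero, smul_eq_mul] at hξ
  have hMl := hM ξ
  rw [hξ, abs_mul, abs_of_pos (by positivity : (0 : ℝ) < n.factorial * 2 ^ (n - 1))] at hMl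
  have hTx1 : |T x| ≤ 1 := Polynomial.Chebyshev.abs_eval_T_real_le_one n hx
  have h2 : (2 : ℝ) ^ n = 2 * 2 ^ (n - 1) := by
    rw [← pow_succ', Nat.sub_add_cancel (Nat.one_le_iff_ne_zero.2 hn)]
  rw [hxl, abs_mul, le_div_iff₀ (by positivity), h2]
  have : |l| * |T x| ≤ |l| * 1 := by gcongr
  calc |l| * |T x| * (2 * 2 ^ (n - 1) * n.factorial)
      ≤ |l| * 1 * (2 * 2 ^ (n - 1) * n.factorial) := by gcongr
    _ = 2 * (|l| * (n.factorial * 2 ^ (n - 1))) := by ring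
    _ ≤ 2 * M := by gcongr

/-! ### Exponential sums vanishing at the Chebyshev nodes -/

theorem iteratedDeriv_re_sum_cexp {ι : Type*} [Fintype ι] (b : ι → ℂ) (a : ι → ℝ) (n : ℕ) :
    iteratedDeriv n (fun t : ℝ => (∑ k, b k * Complex.exp (a k * t * Complex.I)).re) =
      fun t : ℝ => (∑ k, (b k * (a k * Complex.I) ^ n) * Complex.exp (a k * t * Complex.I)).re := by
  induction n generalizing b with
  | zero => simp
  | succ n ih =>
    have hd : deriv (fun t : ℝ => (∑ k, b k * Complex.exp (a k * t * Complex.I)).re) =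
        fun t : ℝ => (∑ k, (b k * (a k * Complex.I)) * Complex.exp (a k * t * Complex.I)).re := by
      funext t
      refine HasDerivAt.deriv (f := fun t : ℝ => (∑ k, b k * Complex.exp (a k * t * Complex.I)).re)
        (HasDerivAt.real_of_complex
          (e := fun t : ℂ => ∑ k, b k * Complex.exp (a k * t * Complex.I))
          (e' := ∑ k, (b k * (a k * Complex.I)) * Complex.exp (a k * t * Complex.I)) ?_)
      refine HasDerivAt.fun_sum fun k _ => ?_
      have h : HasDerivAt (fun t : ℂ => a k * t * Complex.I) (a k * Complex.I) (t : ℂ) := by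
        simpa using ((hasDerivAt_id (t : ℂ)).const_mul (a k : ℂ)).mul_const Complex.I
      refine ((h.cexp).const_mul (b k)).congr_deriv ?_
      ring
    rw [iteratedDeriv_succ', hd, ih]
    simp only [pow_succ', mul_assoc]

theorem contDiff_re_sum_cexp {ι : Type*} [Fintype ι] (b : ι → ℂ) (a : ι → ℝ) (n : ℕ) :
    ContDiff ℝ n (fun t : ℝ => (∑ k, b k * Complex.exp (a k * t * Complex.I)).re) := by
  refine Complex.reCLM.contDiff.comp (ContDiff.sum fun k _ => ?_)
  refine contDiff_const.mul (ContDiff.cexp ?_)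
  exact (contDiff_const.mul Complex.ofRealCLM.contDiff).mul contDiff_const

/-- An exponential sum with frequencies in `[-A, A]` that vanishes at the Chebyshev nodes of
`[-W, W]` is small on `[-W, W]`. -/
theorem norm_sum_cexp_le_of_eq_zero_chebyshev_nodes {ι : Type*} [Fintype ι] (b : ι → ℂ) (a : ι → ℝ)
    {A W : ℝ} (hW : 0 < W) (ha : ∀ k, |a k| ≤ A) {n : ℕ} (hn : n ≠ 0)
    (h0 : ∀ j : Fin n, ∑ k, b k * Complex.exp
      (a k * (W * Real.cos ((2 * (j : ℕ) + 1) * Real.pi / (2 * n)) : ℝ) * Complex.I) = 0)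
    {x : ℝ} (hx : |x| ≤ W) :
    ‖∑ k, b k * Complex.exp (a k * x * Complex.I)‖ ≤
      2 * (A * W) ^ n / (2 ^ n * n.factorial) * ∑ k, ‖b k‖ := by
  set F : ℝ → ℂ := fun x => ∑ k, b k * Complex.exp (a k * x * Complex.I) with hF
  -- rotate the phase so that the value at `x` becomes real
  obtain ⟨c, hc, hcF⟩ : ∃ c : ℂ, ‖c‖ = 1 ∧ c * F x = ‖F x‖ := by
    obtain ⟨c, hc, h⟩ := RCLike.exists_norm_eq_mul_self (F x)
    exact ⟨c, hc, h.symm⟩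
  have hscale : ∀ t : ℝ, c * F (W * t) =
      ∑ k, (c * b k) * Complex.exp ((a k * W : ℝ) * t * Complex.I) := by
    intro t
    simp only [hF, Finset.mul_sum]
    refine Finset.sum_congr rfl fun k _ => ?_
    push_cast
    rw [mul_assoc c, mul_assoc (a k : ℂ) W t]
  have hnode := abs_le_of_eq_zero_chebyshev_nodes hn
    (contDiff_re_sum_cexp (fun k => c * b k) (fun k => a k * W) n)
    (M := (A * W) ^ n * ∑ k, ‖b k‖) (x := x / W) ?_ ?_ ?_
  · rw [← hscale, mul_div_cancel₀ _ hW.ne', hcF, Complex.ofReal_re, abs_norm] at hnode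
    exact hnode.trans_eq (by ring)
  · intro t
    rw [iteratedDeriv_re_sum_cexp]
    refine (Complex.abs_re_le_norm _).trans ((norm_sum_le _ _).trans ?_)
    rw [Finset.mul_sum]
    refine Finset.sum_le_sum fun k _ => ?_
    rw [norm_mul, norm_mul, norm_mul, hc, one_mul, norm_pow, norm_mul, Complex.norm_I, mul_one,
      Complex.norm_real, ← Complex.ofReal_mul, Complex.norm_exp_ofReal_mul_I, mul_one, mul_comm,
      Real.norm_eq_abs, abs_mul, abs_of_pos hW]
    gcongr
    exact ha k
  · intro j
    rw [← hscale, hF]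
    beta_reduce
    rw [h0 j, mul_zero, Complex.zero_re]
  · rwa [abs_div, abs_of_pos hW, div_le_one hW]

/-! ### Rayleigh quotients and dimension count -/

/-- The lower half of the min-max principle: on the sum of the eigenspaces for eigenvalues `≥ μ`,
the Rayleigh quotient is at least `μ`. The operator need only be symmetric on a submodule that
contains these eigenspaces. -/
theorem mul_norm_sq_le_re_inner_of_mem_iSup_eigenspace {E : Type*} [NormedAddCommGroup E]
    [InnerProductSpace ℂ E] (T : E →ₗ[ℂ] E) (S : Submodule ℂ E)
    (hT : ∀ f ∈ S, ∀ g ∈ S, inner ℂ (T f) g = inner ℂ f (T g)) {μ : ℝ}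
    (hS : ∀ ν : ℝ, μ ≤ ν → Module.End.eigenspace T (ν : ℂ) ≤ S) {f : E}
    (hf : f ∈ ⨆ ν ∈ Set.Ici μ, Module.End.eigenspace T ((ν : ℝ) : ℂ)) :
    μ * ‖f‖ ^ 2 ≤ (inner ℂ f (T f)).re := by
  rw [iSup_subtype', Submodule.mem_iSup_iff_exists_finsupp] at hf
  obtain ⟨u, hu, rfl⟩ := hf
  have heig : ∀ ν, T (u ν) = ((ν : ℝ) : ℂ) • u ν := fun ν =>
    Module.End.mem_eigenspace_iff.1 (hu ν)
  have hmem : ∀ ν, u ν ∈ S := fun ν => hS ν ν.2 (hu ν)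
  have horth : ∀ ν ν', ν ≠ ν' → inner ℂ (u ν) (u ν') = 0 := by
    intro ν ν' hne
    have h := hT _ (hmem ν) _ (hmem ν')
    rw [heig, heig, inner_smul_left, inner_smul_right, Complex.conj_ofReal, ← sub_eq_zero,
      ← sub_mul] at h
    exact (mul_eq_zero.1 h).resolve_left fun h =>
      hne (Subtype.ext (Complex.ofReal_injective (sub_eq_zero.1 h)))
  have hexp : ∀ w : Set.Ici μ → ℂ,
      inner ℂ (∑ ν ∈ u.support, u ν) (∑ ν ∈ u.support, w ν • u ν) =
        ∑ ν ∈ u.support, w ν * (‖u ν‖ ^ 2 : ℝ) := by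
    intro w
    rw [sum_inner]
    refine Finset.sum_congr rfl fun ν hν => ?_
    rw [inner_sum, Finset.sum_eq_single ν]
    · rw [inner_smul_right, inner_self_eq_norm_sq_to_K]
      norm_cast
    · intro ν' _ hne
      rw [inner_smul_right, horth _ _ hne.symm, mul_zero]
    · exact fun h => absurd hν h
  have hsum : (u.sum fun _ x => x) = ∑ ν ∈ u.support, u ν := rfl
  rw [hsum, map_sum]
  simp only [heig]
  rw [hexp fun ν => ((ν : ℝ) : ℂ)]
  have hnorm : ‖∑ ν ∈ u.support, u ν‖ ^ 2 = ∑ ν ∈ u.support, ‖u ν‖ ^ 2 := by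
    have h := hexp fun _ => 1
    simp only [one_smul, one_mul] at h
    rw [inner_self_eq_norm_sq_to_K, ← Complex.ofReal_sum] at h
    exact Complex.ofReal_injective (by rw [← h]; push_cast; rfl)
  rw [hnorm, Finset.mul_sum, Complex.re_sum]
  refine Finset.sum_le_sum fun ν _ => ?_
  rw [← Complex.ofReal_mul, Complex.ofReal_re]
  exact mul_le_mul_of_nonneg_right ν.2 (by positivity)

/-- A space of dimension at least `n + 1` contains a nonzero vector satisfying `n` linear
conditions. -/
theorem exists_ne_zero_apply_eq_zero {E : Type} [AddCommGroup E] [Module ℂ E]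
    (V : Submodule ℂ E) {n : ℕ} (hV : ((n + 1 : ℕ) : Cardinal) ≤ Module.rank ℂ V)
    (φ : E →ₗ[ℂ] (Fin n → ℂ)) : ∃ f ∈ V, f ≠ 0 ∧ φ f = 0 := by
  by_contra! h
  have hinj : Function.Injective (φ.domRestrict V) := by
    rw [injective_iff_map_eq_zero]
    intro f hf
    by_contra hne
    exact h f f.2 (by simpa using hne) hf
  have hr := hV.trans (LinearMap.rank_le_of_injective _ hinj)
  rw [rank_fin_fun] at hr
  have : n + 1 ≤ n := by exact_mod_cast hr
  omega

/-! ### The orthonormal system of exponentials -/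

/-- The `k`-th angular frequency `π (2k - (N - 1))`; for `k < N` these are spaced by `2π` and
symmetric about `0`. -/
noncomputable def dpswfFreq (N k : ℕ) : ℝ := Real.pi * (2 * k - (N - 1))

/-- The exponential `x ↦ exp (i π (2k - (N - 1)) x)`. -/
noncomputable def dpswfChar (N k : ℕ) (x : ℝ) : ℂ := Complex.exp (dpswfFreq N k * x * Complex.I)

theorem norm_dpswfChar (N k : ℕ) (x : ℝ) : ‖dpswfChar N k x‖ = 1 := by
  rw [dpswfChar, ← Complex.ofReal_mul, Complex.norm_exp_ofReal_mul_I]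

theorem continuous_dpswfChar (N k : ℕ) : Continuous (dpswfChar N k) := by
  unfold dpswfChar
  fun_prop

theorem conj_dpswfChar (N k : ℕ) (x : ℝ) :
    (starRingEnd ℂ) (dpswfChar N k x) = Complex.exp (-(dpswfFreq N k * x * Complex.I)) := by
  rw [dpswfChar, ← Complex.exp_conj]
  simp

theorem abs_dpswfFreq_le {N k : ℕ} (hk : k < N) : |dpswfFreq N k| ≤ Real.pi * (N - 1) := by
  have h : (k : ℝ) + 1 ≤ N := by exact_mod_cast hk
  rw [dpswfFreq, abs_mul, abs_of_pos Real.pi_pos]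
  refine mul_le_mul_of_nonneg_left (abs_le.2 ⟨?_, ?_⟩) Real.pi_pos.le
  · linarith [(Nat.cast_nonneg k : (0 : ℝ) ≤ k)]
  · linarith

/-- The Dirichlet kernel as a sum of exponentials; multiplied by `sin (π (x - y))`, the sum
telescopes. -/
theorem sin_div_sin_eq_sum (N : ℕ) {x y : ℝ} (h : Real.sin (Real.pi * (x - y)) ≠ 0) :
    ((Real.sin (N * Real.pi * (x - y)) / Real.sin (Real.pi * (x - y)) : ℝ) : ℂ) =
      ∑ k : Fin N, dpswfChar N k x * (starRingEnd ℂ) (dpswfChar N k y) := by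
  have h' : Complex.sin (Real.pi * (x - y)) ≠ 0 := by exact_mod_cast h
  push_cast
  rw [div_eq_iff h', Finset.sum_fin_eq_sum_range]
  have hterm : ∀ k ∈ Finset.range N,
      (if h : k < N then dpswfChar N k x * (starRingEnd ℂ) (dpswfChar N k y) else 0) *
        Complex.sin (Real.pi * (x - y)) =
      Complex.exp (Real.pi * (2 * (k + 1 : ℕ) - N) * (x - y) * Complex.I) * (-Complex.I / 2) -
      Complex.exp (Real.pi * (2 * k - N) * (x - y) * Complex.I) * (-Complex.I / 2) := by
    intro k hk
    rw [dif_pos (Finset.mem_range.1 hk), conj_dpswfChar, dpswfChar, ← Complex.exp_add,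
      Complex.sin]
    have h1 : Complex.exp (Real.pi * (2 * (k + 1 : ℕ) - N) * (x - y) * Complex.I) =
        Complex.exp (dpswfFreq N k * x * Complex.I + -(dpswfFreq N k * y * Complex.I)) *
          Complex.exp (Real.pi * (x - y) * Complex.I) := by
      rw [← Complex.exp_add, dpswfFreq]
      congr 1
      push_cast
      ring
    have h2 : Complex.exp (Real.pi * (2 * k - N) * (x - y) * Complex.I) =
        Complex.exp (dpswfFreq N k * x * Complex.I + -(dpswfFreq N k * y * Complex.I)) *
          Complex.exp (-(Real.pi * (x - y)) * Complex.I) := by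
      rw [← Complex.exp_add, dpswfFreq]
      congr 1
      push_cast
      ring
    rw [h1, h2]
    ring
  rw [Finset.sum_mul, Finset.sum_congr rfl hterm, Finset.sum_range_sub
    (fun k : ℕ => Complex.exp (Real.pi * (2 * k - N) * (x - y) * Complex.I) * (-Complex.I / 2)),
    Complex.sin]
  have h1 : (Real.pi * (2 * (N : ℂ) - N) * (x - y) * Complex.I) =
      N * Real.pi * (x - y) * Complex.I := by ring
  have h2 : (Real.pi * (2 * ((0 : ℕ) : ℂ) - N) * (x - y) * Complex.I) =
      -(N * Real.pi * (x - y)) * Complex.I := by push_cast; ring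
  rw [h1, h2]
  ring

theorem memLp_dpswfChar (N k : ℕ) : MemLp (dpswfChar N k) 2 unitMeasure :=
  MemLp.of_bound (continuous_dpswfChar N k).aestronglyMeasurable 1
    (Filter.Eventually.of_forall fun x => (norm_dpswfChar N k x).le)

/-- The exponential `dpswfChar N k` as an element of `L²(-1/2, 1/2)`. -/
noncomputable def dpswfCharLp (N : ℕ) (k : Fin N) : L2Unit := (memLp_dpswfChar N k).toLp (dpswfChar N k)

theorem integral_conj_dpswfChar_mul (N j k : ℕ) :
    ∫ x, (starRingEnd ℂ) (dpswfChar N j x) * dpswfChar N k x ∂unitMeasure =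
      if j = k then 1 else 0 := by
  have hexp : ∀ x : ℝ, (starRingEnd ℂ) (dpswfChar N j x) * dpswfChar N k x =
      Complex.exp ((2 * Real.pi * ((k : ℤ) - (j : ℤ) : ℤ) * Complex.I) * x) := by
    intro x
    rw [conj_dpswfChar, dpswfChar, ← Complex.exp_add, dpswfFreq, dpswfFreq]
    congr 1
    push_cast
    ring
  simp only [hexp]
  rw [unitMeasure, ← integral_Ioc_eq_integral_Ioo, ← intervalIntegral.integral_of_le (by norm_num)]
  split_ifs with hjk
  · subst hjk
    norm_num
  · have hd : ((k : ℤ) - (j : ℤ) : ℤ) ≠ 0 := by omega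
    have hc : (2 * Real.pi * ((k : ℤ) - (j : ℤ) : ℤ) * Complex.I) ≠ 0 := by
      refine mul_ne_zero (mul_ne_zero (mul_ne_zero two_ne_zero ?_) (Int.cast_ne_zero.2 hd))
        Complex.I_ne_zero
      exact_mod_cast Real.pi_ne_zero
    rw [integral_exp_mul_complex hc, div_eq_zero_iff, sub_eq_zero]
    left
    rw [Complex.exp_eq_exp_iff_exists_int]
    refine ⟨(k : ℤ) - (j : ℤ), ?_⟩
    push_cast
    ring

theorem inner_dpswfCharLp (N : ℕ) (k : Fin N) (g : L2Unit) :
    inner ℂ (dpswfCharLp N k) g = ∫ x, (starRingEnd ℂ) (dpswfChar N k x) * g x ∂unitMeasure := by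
  rw [L2.inner_def]
  refine integral_congr_ae ?_
  filter_upwards [(memLp_dpswfChar N k).coeFn_toLp] with x hx
  rw [dpswfCharLp, hx, RCLike.inner_apply, mul_comm]

theorem orthonormal_dpswfCharLp (N : ℕ) : Orthonormal ℂ (dpswfCharLp N) := by
  rw [orthonormal_iff_ite]
  intro j k
  rw [inner_dpswfCharLp]
  have h : ∫ x, (starRingEnd ℂ) (dpswfChar N j x) * dpswfCharLp N k x ∂unitMeasure =
      ∫ x, (starRingEnd ℂ) (dpswfChar N j x) * dpswfChar N k x ∂unitMeasure := by
    refine integral_congr_ae ?_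
    filter_upwards [(memLp_dpswfChar N k).coeFn_toLp] with x hx
    rw [dpswfCharLp, hx]
  rw [h, integral_conj_dpswfChar_mul]
  simp only [Fin.ext_iff]

theorem coeFn_sum_smul_dpswfCharLp {N : ℕ} (b : Fin N → ℂ) :
    (∑ k, b k • dpswfCharLp N k : L2Unit) =ᵐ[unitMeasure]
      fun x => ∑ k, b k * dpswfChar N k x := by
  suffices h : ∀ s : Finset (Fin N), (∑ k ∈ s, b k • dpswfCharLp N k : L2Unit) =ᵐ[unitMeasure]
      fun x => ∑ k ∈ s, b k * dpswfChar N k x from h Finset.univ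
  intro s
  induction s using Finset.induction_on with
  | empty =>
    filter_upwards [Lp.coeFn_zero ℂ 2 unitMeasure] with x hx
    simpa using hx
  | insert k s hk ih =>
    rw [Finset.sum_insert hk]
    filter_upwards [ih, Lp.coeFn_add (b k • dpswfCharLp N k) (∑ k ∈ s, b k • dpswfCharLp N k),
      Lp.coeFn_smul (b k) (dpswfCharLp N k), (memLp_dpswfChar N k).coeFn_toLp] with x h1 h2 h3 h4
    rw [h2, Pi.add_apply, h3, Pi.smul_apply, h1, Finset.sum_insert hk, dpswfCharLp, h4, smul_eq_mul]

/-! ### The operator as an integral over the window -/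

/-- Lebesgue measure on `(-1/2, 1/2) ∩ [-W, W]`, the domain of integration of the operator. -/
noncomputable def windowMeasure (W : ℝ) : Measure ℝ := unitMeasure.restrict (Set.Icc (-W) W)

instance (W : ℝ) : IsFiniteMeasure (windowMeasure W) := by
  unfold windowMeasure
  infer_instance

theorem windowMeasure_real_univ_le {W : ℝ} (hW : 0 ≤ W) :
    (windowMeasure W).real Set.univ ≤ 2 * W := by
  rw [windowMeasure, unitMeasure, measureReal_restrict_apply_univ]
  calc (volume.restrict (Set.Ioo (-1 / 2 : ℝ) (1 / 2))).real (Set.Icc (-W) W)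
      ≤ volume.real (Set.Icc (-W) W) :=
        ENNReal.toReal_mono (by simp) (Measure.restrict_apply_le _ _)
    _ = 2 * W := by
        rw [Real.volume_real_Icc_of_le (by linarith)]
        ring

theorem ae_norm_le_of_windowMeasure (W : ℝ) : ∀ᵐ x ∂windowMeasure W, |x| ≤ W := by
  filter_upwards [ae_restrict_mem (μ := unitMeasure) (measurableSet_Icc (a := -W) (b := W))]
    with x hx
  exact abs_le.2 hx

theorem integrable_conj_dpswfChar_mul (N k : ℕ) (W : ℝ) (f : L2Unit) :
    Integrable (fun y => (starRingEnd ℂ) (dpswfChar N k y) * f y) (windowMeasure W) := by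
  have hf : Integrable f unitMeasure := (Lp.memLp f).integrable (by norm_num)
  refine Integrable.bdd_mul (c := 1) hf.restrict ?_ ?_
  · exact (Complex.continuous_conj.comp (continuous_dpswfChar N k)).aestronglyMeasurable
  · refine Filter.Eventually.of_forall fun x => ?_
    rw [RCLike.norm_conj, norm_dpswfChar]

theorem integral_dpswfKernel_mul (N : ℕ) (W : ℝ) (f : L2Unit) {x : ℝ}
    (hx : x ∈ Set.Ioo (-1 / 2 : ℝ) (1 / 2)) :
    ∫ y, (dpswfKernel N W x y : ℂ) * f y ∂unitMeasure =
      ∑ k : Fin N, (∫ y, (starRingEnd ℂ) (dpswfChar N k y) * f y ∂windowMeasure W) *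
        dpswfChar N k x := by
  have hker : (fun y => (dpswfKernel N W x y : ℂ) * f y) =ᵐ[unitMeasure]
      (Set.Icc (-W) W).indicator fun y => ∑ k : Fin N,
        ((starRingEnd ℂ) (dpswfChar N k y) * f y) * dpswfChar N k x := by
    have hne : ∀ᵐ y ∂unitMeasure, y ≠ x := by
      refine ae_restrict_of_ae ?_
      exact Measure.ae_ne volume x
    filter_upwards [hne, ae_restrict_mem (μ := volume)
      (measurableSet_Ioo (a := (-1 / 2 : ℝ)) (b := 1 / 2))] with y hy hyI
    -- `0 < |x - y| < 1`, so `x - y` is not an integer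
    have hsin : Real.sin (Real.pi * (x - y)) ≠ 0 := by
      intro h0
      obtain ⟨m, hm⟩ := Real.sin_eq_zero_iff.1 h0
      have hm' : (m : ℝ) = x - y := by
        have := Real.pi_pos
        field_simp at hm
        linarith
      have h1 : (m : ℝ) < 1 := by rw [hm']; linarith [hx.2, hyI.1]
      have h2 : (-1 : ℝ) < m := by rw [hm']; linarith [hx.1, hyI.2]
      have h3 : m < 1 := by exact_mod_cast h1
      have h4 : -1 < m := by exact_mod_cast h2
      have h5 : m = 0 := by omega
      rw [h5, Int.cast_zero] at hm'
      exact hy (by linarith)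
    by_cases hyW : y ∈ Set.Icc (-W) W
    · rw [Set.indicator_of_mem hyW, dpswfKernel, Set.indicator_of_mem hyW, mul_one,
        sin_div_sin_eq_sum N hsin, Finset.sum_mul]
      refine Finset.sum_congr rfl fun k _ => ?_
      ring
    · rw [Set.indicator_of_notMem hyW, dpswfKernel, Set.indicator_of_notMem hyW]
      simp
  rw [integral_congr_ae hker, integral_indicator measurableSet_Icc, ← windowMeasure,
    integral_finsetSum]
  · simp only [integral_mul_const]
  · exact fun k _ => (integrable_conj_dpswfChar_mul N k W f).mul_const _

theorem dpswfOperator_apply (N : ℕ) (W : ℝ) (f : L2Unit) :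
    dpswfOperator N W f =
      ∑ k : Fin N, (∫ y, (starRingEnd ℂ) (dpswfChar N k y) * f y ∂windowMeasure W) •
        dpswfCharLp N k := by
  refine Lp.ext ?_
  filter_upwards [(memLp_dpswfKernel_integral N W f).coeFn_toLp,
    coeFn_sum_smul_dpswfCharLp (fun k : Fin N =>
      ∫ y, (starRingEnd ℂ) (dpswfChar N k y) * f y ∂windowMeasure W),
    ae_restrict_mem (μ := volume) (measurableSet_Ioo (a := (-1 / 2 : ℝ)) (b := 1 / 2))]
    with x h1 h2 hx
  rw [h2, ← integral_dpswfKernel_mul N W f hx, ← h1]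
  rfl

/-- On the span of the exponentials, the sesquilinear form of the operator is the `L²` inner product
over the window. -/
theorem inner_dpswfOperator (N : ℕ) (W : ℝ) (b c : Fin N → ℂ) :
    inner ℂ (∑ k, b k • dpswfCharLp N k) (dpswfOperator N W (∑ k, c k • dpswfCharLp N k)) =
      ∫ x, (starRingEnd ℂ) (∑ k, b k * dpswfChar N k x) * (∑ k, c k * dpswfChar N k x)
        ∂windowMeasure W := by
  rw [dpswfOperator_apply, (orthonormal_dpswfCharLp N).inner_sum]
  simp only [← integral_const_mul]
  rw [← integral_finsetSum _ (fun (k : Fin N) _ =>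
    (integrable_conj_dpswfChar_mul N (k : ℕ) W (∑ k, c k • dpswfCharLp N k)).const_mul
      ((starRingEnd ℂ) (b k)))]
  refine integral_congr_ae ?_
  filter_upwards [ae_restrict_of_ae (s := Set.Icc (-W) W) (coeFn_sum_smul_dpswfCharLp c)] with x hx
  rw [hx, map_sum, Finset.sum_mul]
  refine Finset.sum_congr rfl fun k _ => ?_
  rw [map_mul, mul_assoc]

theorem dpswfOperator_apply_mem_span (N : ℕ) (W : ℝ) (f : L2Unit) :
    dpswfOperator N W f ∈ Submodule.span ℂ (Set.range (dpswfCharLp N)) := by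
  rw [dpswfOperator_apply]
  exact Submodule.sum_mem _ fun k _ =>
    Submodule.smul_mem _ _ (Submodule.subset_span (Set.mem_range_self k))

theorem eigenspace_dpswfOperator_le (N : ℕ) (W : ℝ) {ν : ℂ} (hν : ν ≠ 0) :
    Module.End.eigenspace (dpswfOperator N W) ν ≤
      Submodule.span ℂ (Set.range (dpswfCharLp N)) := by
  intro f hf
  rw [Module.End.mem_eigenspace_iff] at hf
  have h : f = ν⁻¹ • dpswfOperator N W f := by rw [hf, inv_smul_smul₀ hν]
  rw [h]
  exact Submodule.smul_mem _ _ (dpswfOperator_apply_mem_span N W f)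

theorem inner_dpswfOperator_left (N : ℕ) (W : ℝ) :
    ∀ f ∈ Submodule.span ℂ (Set.range (dpswfCharLp N)),
      ∀ g ∈ Submodule.span ℂ (Set.range (dpswfCharLp N)),
        inner ℂ (dpswfOperator N W f) g = inner ℂ f (dpswfOperator N W g) := by
  intro f hf g hg
  obtain ⟨b, rfl⟩ := (Submodule.mem_span_range_iff_exists_fun ℂ).1 hf
  obtain ⟨c, rfl⟩ := (Submodule.mem_span_range_iff_exists_fun ℂ).1 hg
  rw [← inner_conj_symm, inner_dpswfOperator, inner_dpswfOperator, ← integral_conj]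
  refine integral_congr_ae (Filter.Eventually.of_forall fun x => ?_)
  simp only [map_mul, RCLike.conj_conj]
  rw [mul_comm]

/-- The energy in the window of an exponential sum that vanishes at the `n` Chebyshev nodes of
`[-W, W]`. The factor `N` comes from Cauchy–Schwarz, `(∑ ‖b k‖)² ≤ N ∑ ‖b k‖²`. -/
theorem re_inner_dpswfOperator_le {N : ℕ} {W : ℝ} (hW : 0 < W) {n : ℕ} (hn : n ≠ 0)
    (b : Fin N → ℂ)
    (h0 : ∀ j : Fin n, ∑ k : Fin N,
      b k * dpswfChar N k (W * Real.cos ((2 * (j : ℕ) + 1) * Real.pi / (2 * n))) = 0) :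
    (inner ℂ (∑ k, b k • dpswfCharLp N k)
        (dpswfOperator N W (∑ k, b k • dpswfCharLp N k))).re ≤
      2 * W * (N * (2 * (Real.pi * (N - 1) * W) ^ n / (2 ^ n * n.factorial)) ^ 2) *
        ‖∑ k, b k • dpswfCharLp N k‖ ^ 2 := by
  set K : ℝ := 2 * (Real.pi * (N - 1) * W) ^ n / (2 ^ n * n.factorial) with hK
  have hnorm : ‖∑ k, b k • dpswfCharLp N k‖ ^ 2 = ∑ k, ‖b k‖ ^ 2 := by
    have h := (orthonormal_dpswfCharLp N).inner_sum b b Finset.univ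
    rw [inner_self_eq_norm_sq_to_K] at h
    simp only [Complex.conj_mul'] at h
    exact Complex.ofReal_injective (by push_cast; exact h)
  have hpt : ∀ x : ℝ, |x| ≤ W → ‖∑ k : Fin N, b k * dpswfChar N k x‖ ≤ K * ∑ k, ‖b k‖ :=
    fun x hx => norm_sum_cexp_le_of_eq_zero_chebyshev_nodes b (fun k : Fin N => dpswfFreq N k) hW
      (fun k => abs_dpswfFreq_le k.2) hn h0 hx
  have hcs : (∑ k, ‖b k‖) ^ 2 ≤ N * ∑ k, ‖b k‖ ^ 2 := by
    simpa using sq_sum_le_card_mul_sum_sq (s := Finset.univ) (f := fun k => ‖b k‖)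
  rw [inner_dpswfOperator, hnorm]
  refine (Complex.re_le_norm _).trans ?_
  refine (norm_integral_le_of_norm_le_const (C := K ^ 2 * (N * ∑ k, ‖b k‖ ^ 2)) ?_).trans ?_
  · filter_upwards [ae_norm_le_of_windowMeasure W] with x hx
    rw [norm_mul, RCLike.norm_conj, ← sq]
    calc ‖∑ k : Fin N, b k * dpswfChar N k x‖ ^ 2 ≤ (K * ∑ k, ‖b k‖) ^ 2 := by
          gcongr
          exact hpt x hx
      _ = K ^ 2 * (∑ k, ‖b k‖) ^ 2 := mul_pow _ _ _
      _ ≤ K ^ 2 * (N * ∑ k, ‖b k‖ ^ 2) := by gcongr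
  · calc K ^ 2 * (N * ∑ k, ‖b k‖ ^ 2) * (windowMeasure W).real Set.univ
        ≤ K ^ 2 * (N * ∑ k, ‖b k‖ ^ 2) * (2 * W) := by
          gcongr
          exact windowMeasure_real_univ_le hW.le
      _ = 2 * W * (N * K ^ 2) * ∑ k, ‖b k‖ ^ 2 := by ring

/-! ### Numerical comparison -/

/-- Stirling's bound `√(2πn) (n/e)ⁿ ≤ n!` turns the Chebyshev error into a power of
`x = eπWm / (2n)`. -/
theorem chebyshev_error_le_stirling {W m x : ℝ} (hW0 : 0 < W) (hm : 1 ≤ m) {n : ℕ}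
    (hn0 : 0 < n) (hx : x = Real.exp 1 * Real.pi * W * m / (2 * n)) :
    2 * W * ((m + 1) * (2 * (Real.pi * m * W) ^ n / (2 ^ n * n.factorial)) ^ 2) ≤
      16 * x * x ^ (2 * n) / (Real.exp 1 * Real.pi ^ 2) := by
  have hst := Stirling.le_factorial_stirling n
  have hEp := Real.exp_pos 1
  have hPp := Real.pi_pos
  generalize Real.exp 1 = E at *
  generalize Real.pi = P at *
  have hn : (0 : ℝ) < n := by exact_mod_cast hn0
  have hxp : 0 < x := by rw [hx]; positivity
  have h1 : (P * m * W) ^ n = 2 ^ n * (x ^ n * (n / E) ^ n) := by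
    rw [← mul_pow, ← mul_pow, hx]
    congr 1
    field_simp
  have h2 : 2 * (P * m * W) ^ n / (2 ^ n * n.factorial) ≤ 2 * x ^ n / √(2 * P * n) := by
    rw [h1, div_le_div_iff₀ (by positivity) (by positivity)]
    calc 2 * (2 ^ n * (x ^ n * (n / E) ^ n)) * √(2 * P * n)
        = 2 * x ^ n * (2 ^ n * (√(2 * P * n) * (n / E) ^ n)) := by ring
      _ ≤ 2 * x ^ n * (2 ^ n * n.factorial) := by gcongr
  calc 2 * W * ((m + 1) * (2 * (P * m * W) ^ n / (2 ^ n * n.factorial)) ^ 2)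
      ≤ 2 * W * ((2 * m) * (2 * x ^ n / √(2 * P * n)) ^ 2) := by gcongr; linarith
    _ = W * (E * P * m) * (8 * x ^ (2 * n) / (E * P ^ 2 * n)) := by
        rw [div_pow, Real.sq_sqrt (by positivity), mul_pow, ← pow_mul, mul_comm n 2]
        field_simp
        ring
    _ = 16 * x * x ^ (2 * n) / (E * P ^ 2) := by
        have hWx : W * (E * P * m) = 2 * n * x := by rw [hx]; field_simp
        rw [hWx]
        field_simp
        ring

/-- A lower bound for the target in terms of `x = eπWm / (2n)` alone: the summand `2` of
`2 + 2 / (eπW)` is dropped, and `√(2W) √m √x = 2x √n / √(eπ)` eliminates `W` and `m`. -/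
theorem le_div_sqrt_mul_log_mul_rpow {W m x : ℝ} (hW0 : 0 < W) (hm : 0 < m) {n : ℕ}
    (hn0 : 0 < n) (hx : x = Real.exp 1 * Real.pi * W * m / (2 * n)) {L : ℝ} (hL : 0 < L) :
    2 * x ^ n / (√(Real.exp 1 * Real.pi) * √n * x * L) ≤
      √(2 * W) * (2 + 2 / (Real.exp 1 * Real.pi * W)) / (√m * L) * x ^ ((n : ℝ) - 1 / 2) := by
  have hEp := Real.exp_pos 1
  have hPp := Real.pi_pos
  generalize Real.exp 1 = E at *
  generalize Real.pi = P at *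
  have hn : (0 : ℝ) < n := by exact_mod_cast hn0
  have hxp : 0 < x := by rw [hx]; positivity
  have hpow : x ^ ((n : ℝ) - 1 / 2) = x ^ n / √x := by
    rw [Real.rpow_sub hxp, Real.rpow_natCast, Real.sqrt_eq_rpow]
  have hs : √(2 * W) * √m * √x = 2 * x * √n / √(E * P) := by
    rw [← Real.sqrt_mul (by positivity), ← Real.sqrt_mul (by positivity)]
    have hWx : W * (E * P * m) = 2 * n * x := by rw [hx]; field_simp
    have : 2 * W * m * x = (2 * x) ^ 2 * n / (E * P) := by
      field_simp
      linear_combination hWx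
    rw [this, Real.sqrt_div (by positivity), Real.sqrt_mul (by positivity),
      Real.sqrt_sq (by positivity)]
  have key : ∀ q : ℝ, 0 < q → q ^ 2 = E * P →
      2 * x ^ n / (q * √n * x * L) = 4 * x ^ n / (E * P * (2 * x * √n / q) * L) := by
    intro q hq hqq
    rw [← hqq]
    field_simp
    norm_num
  calc 2 * x ^ n / (√(E * P) * √n * x * L)
      = 4 * x ^ n / (E * P * (√(2 * W) * √m * √x) * L) := by
        rw [hs]
        exact key _ (by positivity) (Real.sq_sqrt (by positivity))
    _ = √(2 * W) * (2 / (E * P * W)) / (√m * L) * (x ^ n / √x) := by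
        have hq : √(2 * W) ^ 2 = 2 * W := Real.sq_sqrt (by positivity)
        field_simp
        linear_combination (-2) * hq
    _ ≤ √(2 * W) * (2 + 2 / (E * P * W)) / (√m * L) * (x ^ n / √x) := by gcongr; linarith
    _ = _ := by rw [hpow]

/-- This is `log y ≤ y` for `y = x⁻¹ ^ (n + 2)`; it compensates the singularity of `1 / log x⁻¹` at
`x = 1`. -/
theorem pow_mul_log_inv_le {x : ℝ} (hx : 0 < x) (n : ℕ) :
    (n + 2) * Real.log x⁻¹ * x ^ (n + 2) ≤ 1 := by
  have h := Real.log_le_self (x := (x⁻¹) ^ (n + 2)) (by positivity)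
  rw [Real.log_pow, inv_pow] at h
  push_cast at h
  calc (n + 2) * Real.log x⁻¹ * x ^ (n + 2) ≤ (x ^ (n + 2))⁻¹ * x ^ (n + 2) := by gcongr
    _ = 1 := inv_mul_cancel₀ (by positivity)

/-- The energy bound from the Chebyshev nodes is at most the claimed eigenvalue bound. -/
theorem energy_bound_le {W : ℝ} (hW0 : 0 < W) {N : ℕ} (hN : 2 ≤ N) {n : ℕ}
    (hn : Real.exp 1 * Real.pi * W * ((N : ℝ) - 1) / 2 < (n : ℝ)) :
    2 * W * (N * (2 * (Real.pi * (N - 1) * W) ^ n / (2 ^ n * n.factorial)) ^ 2) ≤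
      (√(2 * W) * (2 + 2 / (Real.exp 1 * Real.pi * W))) /
          (√((N : ℝ) - 1) *
            Real.log (2 * (n : ℝ) / (Real.exp 1 * Real.pi * W * ((N : ℝ) - 1)))) *
        (Real.exp 1 * Real.pi * W * ((N : ℝ) - 1) / (2 * (n : ℝ))) ^ ((n : ℝ) - 1 / 2) := by
  have hN' : (2 : ℝ) ≤ N := by exact_mod_cast hN
  obtain ⟨m, hm⟩ : ∃ m : ℝ, m = N - 1 := ⟨_, rfl⟩
  have hNm : (N : ℝ) = m + 1 := by linarith
  rw [← hm] at hn ⊢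
  have hm1 : 1 ≤ m := by linarith
  have hn0 : (0 : ℝ) < n := lt_of_le_of_lt (by positivity) hn
  have hn0' : 0 < n := by exact_mod_cast hn0
  obtain ⟨x, hx⟩ : ∃ x : ℝ, x = Real.exp 1 * Real.pi * W * m / (2 * n) := ⟨_, rfl⟩
  have hxp : 0 < x := by rw [hx]; positivity
  have hx1 : x < 1 := by
    rw [hx, div_lt_one (by positivity)]
    linarith
  have hinv : 2 * (n : ℝ) / (Real.exp 1 * Real.pi * W * m) = x⁻¹ := by rw [hx, inv_div]
  have hL : 0 < Real.log x⁻¹ := Real.log_pos ((one_lt_inv₀ hxp).2 hx1)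
  have hLx := pow_mul_log_inv_le hxp n
  rw [hinv, ← hx, hNm]
  refine (chebyshev_error_le_stirling hW0 hm1 hn0' hx).trans
    (le_trans ?_ (le_div_sqrt_mul_log_mul_rpow hW0 (by linarith) hn0' hx hL))
  have hE2 : (2.7 : ℝ) < Real.exp 1 := by linarith [Real.exp_one_gt_d9]
  have hE3 : Real.exp 1 < 2.72 := by linarith [Real.exp_one_lt_d9]
  have hP2 := Real.pi_gt_d2
  have hP3 := Real.pi_lt_d2
  generalize Real.log x⁻¹ = L at *
  generalize Real.exp 1 = E at *
  generalize Real.pi = P at *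
  have hEPs : √(E * P) ≤ 3 := by
    rw [Real.sqrt_le_left (by norm_num)]
    nlinarith
  have hns : √(n : ℝ) ≤ (n + 2) / 2 := by
    rw [Real.sqrt_le_left (by positivity)]
    nlinarith [sq_nonneg (n : ℝ)]
  have hEP2 : 12 ≤ E * P ^ 2 := by nlinarith
  have hEp : 0 < E := by linarith
  have hPp : 0 < P := by linarith
  rw [div_le_div_iff₀ (by positivity) (by positivity)]
  calc 16 * x * x ^ (2 * n) * (√(E * P) * √n * x * L)
      = 16 * √(E * P) * x ^ n * (√n * L * x ^ (n + 2)) := by ring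
    _ ≤ 16 * 3 * x ^ n * ((n + 2) / 2 * L * x ^ (n + 2)) := by gcongr
    _ = 24 * x ^ n * ((n + 2) * L * x ^ (n + 2)) := by ring
    _ ≤ 24 * x ^ n * 1 := by gcongr
    _ = 2 * x ^ n * 12 := by ring
    _ ≤ 2 * x ^ n * (E * P ^ 2) := by gcongr

/-! ### The eigenvalue bound -/

theorem lemma1 (W : ℝ) (hW0 : 0 < W) (hW : W < 2 / (Real.exp 1 * Real.pi))
    (N : ℕ) (hN : 2 ≤ N) (n : ℕ)
    (hn : Real.exp 1 * Real.pi * W * ((N : ℝ) - 1) / 2 < (n : ℝ)) (hnN : n ≤ N - 1) :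
    dpswfEigenvalue N W n ≤
      (√(2 * W) * (2 + 2 / (Real.exp 1 * Real.pi * W))) /
          (√((N : ℝ) - 1) *
            Real.log (2 * (n : ℝ) / (Real.exp 1 * Real.pi * W * ((N : ℝ) - 1)))) *
        (Real.exp 1 * Real.pi * W * ((N : ℝ) - 1) / (2 * (n : ℝ))) ^ ((n : ℝ) - 1 / 2) := by
  have hN1 : (0 : ℝ) ≤ (N : ℝ) - 1 := by
    have : (2 : ℝ) ≤ N := by exact_mod_cast hN
    linarith
  -- the hypothesis on `n` excludes `n = 0`, so there is at least one node
  have hn0 : n ≠ 0 := by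
    rintro rfl
    have : (0 : ℝ) ≤ Real.exp 1 * Real.pi * W * ((N : ℝ) - 1) / 2 := by positivity
    rw [Nat.cast_zero] at hn
    linarith
  refine le_trans (Real.sSup_le ?_ (by positivity)) (energy_bound_le hW0 hN hn)
  rintro μ ⟨hμ, hrank⟩
  -- `φ f` lists the values of the exponential sum of `f` at the `n` Chebyshev nodes of `[-W, W]`
  let φ : L2Unit →ₗ[ℂ] (Fin n → ℂ) := LinearMap.pi fun j => ∑ k : Fin N,
    dpswfChar N k (W * Real.cos ((2 * (j : ℕ) + 1) * Real.pi / (2 * n))) •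
      innerₛₗ ℂ (dpswfCharLp N k)
  obtain ⟨f, hfV, hf0, hφ⟩ := exists_ne_zero_apply_eq_zero _ hrank φ
  have hS : ∀ ν : ℝ, μ ≤ ν → Module.End.eigenspace (dpswfOperator N W) (ν : ℂ) ≤
      Submodule.span ℂ (Set.range (dpswfCharLp N)) := fun ν hν =>
    eigenspace_dpswfOperator_le N W (Complex.ofReal_ne_zero.2 (hμ.trans_le hν).ne')
  have hlow := mul_norm_sq_le_re_inner_of_mem_iSup_eigenspace (dpswfOperator N W) _
    (inner_dpswfOperator_left N W) hS hfV
  obtain ⟨b, rfl⟩ := (Submodule.mem_span_range_iff_exists_fun ℂ).1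
    ((iSup₂_le fun ν hν => hS ν hν : _ ≤ Submodule.span ℂ (Set.range (dpswfCharLp N))) hfV)
  have hup := re_inner_dpswfOperator_le hW0 hn0 b fun j => by
    have h := congrFun hφ j
    simp only [φ, LinearMap.pi_apply, LinearMap.sum_apply, LinearMap.smul_apply,
      innerₛₗ_apply_apply, (orthonormal_dpswfCharLp N).inner_right_fintype, smul_eq_mul,
      Pi.zero_apply] at h
    rw [← h]
    exact Finset.sum_congr rfl fun k _ => mul_comm _ _
  exact le_of_mul_le_mul_right (hlow.trans hup) (by positivity)
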